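/- Let $s\ge 2$, let $T$ be a set of $s$ types of open parentheses, each $a\in T$ having exactly one congruent close parenthesis $\bar a$, and let $\mathrm{Dyck}(s)$ be the set of strings over $\Sigma=T\cup\bar T$ generated by $S\to SS$, $S\to\varepsilon$, $S\to aS\bar a$ ($a\in T$). For $\sigma\in\Sigma^*$ of length $n$ let $d$ be the minimum, over $\tau\in\mathrm{Dyck}(s)$, of the number of single-symbol insertions, deletions and substitutions that turn $\sigma$ into $\tau$. The algorithm Random-deletion scans $\sigma$ from left to right with an initially empty stack. An open parenthesis is pushed. A close parenthesis is matched with the stack top (which is popped) if the two are congruent, and is deleted if the stack is empty; if the stack top does not match it, a fresh fair coin decides whether the stack top or the current close parenthesis is deleted (in the first case the current close parenthesis is compared with the new stack top). When the scan has ended, all symbols left on the stack are deleted. The time is the number of steps, a step being one push, one match or one deletion. There are absolute constants $C$ and $p>0$ such that for all $s\ge2$ and all $\sigma\in\Sigma^*$ of length $n$, Random-deletion on $\sigma$ always halts within $C\,n$ steps; it always outputs a set of positions of $\sigma$ whose removal leaves a string $\sigma''\in\mathrm{Dyck}(s)$, so that the number $E$ of deleted symbols satisfies $d\le E$ and the string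 edit distance between $\sigma$ and $\sigma''$ is at most $E$; and with probability at least $p$ one has $E\le 4d\cdot d$. That is, Random-deletion is a linear-time $4d$-approximation, with constant probability, for edit distance to $\mathrm{Dyck}(s)$. -/

import Mathlib

/-- Parentheses of `s` types: `opn a` is the open parenthesis of type `a`, and `cls a` is the close
parenthesis congruent to it. -/
inductive Paren (s : ℕ) where
  | opn (a : Fin s) : Paren s
  | cls (a : Fin s) : Paren s
deriving DecidableEq

/-- `Dyck(s)`: the strings generated by `S → SS`, `S → ε` and `S → a S ā` for every type `a`. -/
inductive Dyck {s : ℕ} : List (Paren s) → Prop where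
  | nil : Dyck []
  | append {u v : List (Paren s)} : Dyck u → Dyck v → Dyck (u ++ v)
  | wrap (a : Fin s) {u : List (Paren s)} : Dyck u → Dyck (Paren.opn a :: (u ++ [Paren.cls a]))

/-- A single edit of a string: an insertion, a deletion or a substitution of one symbol. -/
inductive EditStep {α : Type} : List α → List α → Prop where
  | insert (u v : List α) (x : α) : EditStep (u ++ v) (u ++ x :: v)
  | delete (u v : List α) (x : α) : EditStep (u ++ x :: v) (u ++ v)
  | subst (u v : List α) (x y : α) : EditStep (u ++ x :: v) (u ++ y :: v)

/-- `Edits k σ τ`: a sequence of exactly `k` single edits turns `σ` into `τ`. -/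
inductive Edits {α : Type} : ℕ → List α → List α → Prop where
  | refl (σ : List α) : Edits 0 σ σ
  | step {k : ℕ} {σ ρ τ : List α} : EditStep σ ρ → Edits k ρ τ → Edits (k + 1) σ τ

/-- String edit distance: the least number of single edits that turn `σ` into `τ`. Such a number
exists, as one can delete all of `σ` and then insert all of `τ`. -/
noncomputable def strEdit {α : Type} (σ τ : List α) : ℕ :=
  sInf {k : ℕ | Edits k σ τ}

/-- The optimum edit distance from `σ` to `Dyck(s)`. The set is nonempty, as `[]` is in `Dyck(s)`,
so the infimum is a minimum. -/
noncomputable def dyckDist {s : ℕ} (σ : List (Paren s)) : ℕ :=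
  sInf {k : ℕ | ∃ τ : List (Paren s), Dyck τ ∧ strEdit σ τ = k}

namespace RandomDeletion

/-- A configuration of the stack machine: the unread part of the input (each symbol with its
position in the original string), the stack (top first; it only ever holds open parentheses,
given by type and position), and the output, a list of the deleted positions. -/
structure Config (s : ℕ) where
  input : List (Paren s × ℕ)
  stack : List (Fin s × ℕ)
  deleted : List ℕ

/-- The start: the whole string unread (positions are counted from `0`), stack and output empty. -/
def init {s : ℕ} (σ : List (Paren s)) : Config s := ⟨σ.zipIdx, [], []⟩

/-- The machine has halted when the scan has ended and the stack is empty. -/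
def Config.Halted {s : ℕ} (c : Config s) : Prop := c.input = [] ∧ c.stack = []

/-- One step of Random-deletion, a unit of time. It inspects only the current symbol and the stack
top, tosses at most one coin, and does exactly one of: push the current symbol; match it with the
stack top; delete it; delete the stack top. A halted machine stays as it is. -/
noncomputable def step {s : ℕ} : Config s → PMF (Config s)
  | ⟨[], [], D⟩ => PMF.pure ⟨[], [], D⟩
  | ⟨[], (_, i) :: S, D⟩ => PMF.pure ⟨[], S, i :: D⟩
  | ⟨(Paren.opn a, i) :: I, S, D⟩ => PMF.pure ⟨I, (a, i) :: S, D⟩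
  | ⟨(Paren.cls _, j) :: I, [], D⟩ => PMF.pure ⟨I, [], j :: D⟩
  | ⟨(Paren.cls b, j) :: I, (a, i) :: S, D⟩ =>
    if a = b then PMF.pure ⟨I, S, D⟩
    else (PMF.uniformOfFintype Bool).bind fun coin =>
      if coin then PMF.pure ⟨(Paren.cls b, j) :: I, S, i :: D⟩
      else PMF.pure ⟨I, (a, i) :: S, j :: D⟩

/-- The distribution of the configuration after `t` steps from `c`, with fresh coins at each step. -/
noncomputable def run {s : ℕ} : ℕ → Config s → PMF (Config s)
  | 0, c => PMF.pure c
  | t + 1, c => (step c).bind (run t)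

/-- The number of edit operations (all of them deletions) performed so far. -/
def Config.edits {s : ℕ} (c : Config s) : ℕ := c.deleted.length

/-- The string `σ` with the symbols at the deleted positions removed. -/
def Config.result {s : ℕ} (c : Config s) (σ : List (Paren s)) : List (Paren s) :=
  (σ.zipIdx.filter fun x => x.2 ∉ c.deleted).map Prod.fst

end RandomDeletion

/-! Call the stack followed by the unread input the residual string, and let `m` bound the number of
deletions that make it Dyck. Initially `m = 2d` works, since one edit can be replaced by at most two
deletions (`Edits.deletionBound`). A push or a match preserves `m`, and a forced deletion lowers it
by one. At a mismatch one of the two coin outcomes lowers `m` by one, while the other raises it by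
at most one (`DeletionBound.mismatched`, `DeletionBound.remove`). Once `m = 0` nothing more is
deleted.

So the number of deletions is dominated by the time the fair walk from `2d` takes to reach `0`
(`hitProb_le_run`), and a space-time harmonic polynomial shows that `4d²` steps suffice with
probability at least `1/9` (`one_div_nine_le_hitProb`). Halting and correctness hold for all coins,
by a potential and an invariant (`Invariant.run`, `Invariant.correct`). -/

open List

/-! ### Dyck strings -/

section DyckStrings

variable {s : ℕ}

/-- Scan with a stack: `Accepts S w` says that `w` closes exactly the parentheses open on `S`. -/
def Accepts : List (Fin s) → List (Paren s) → Prop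
  | S, [] => S = []
  | S, Paren.opn a :: w => Accepts (a :: S) w
  | [], Paren.cls _ :: _ => False
  | a :: S, Paren.cls b :: w => a = b ∧ Accepts S w

theorem Dyck.accepts_append {u : List (Paren s)} (hu : Dyck u) :
    ∀ (S : List (Fin s)) (v : List (Paren s)), Accepts S (u ++ v) ↔ Accepts S v := by
  induction hu with
  | nil => simp
  | append _ _ ih₁ ih₂ => intro S v; rw [List.append_assoc, ih₁, ih₂]
  | wrap a _ ih =>
    intro S v
    simp [Accepts, ih]

theorem Dyck.accepts {u : List (Paren s)} (hu : Dyck u) : Accepts [] u := by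
  have h := (hu.accepts_append [] []).2 rfl
  simpa using h

/-- In `Accepts.dyck` this puts a matched pair back into the string from which it was cancelled. -/
theorem Dyck.insert {w m : List (Paren s)} (hw : Dyck w) (hm : Dyck m) :
    ∀ u v : List (Paren s), w = u ++ v → Dyck (u ++ (m ++ v)) := by
  induction hw with
  | nil =>
    intro u v h
    obtain ⟨rfl, rfl⟩ := List.append_eq_nil_iff.1 h.symm
    simpa using hm
  | @append p q hp hq ihp ihq =>
    intro u v h
    rcases List.append_eq_append_iff.1 h with ⟨r, rfl, rfl⟩ | ⟨r, rfl, rfl⟩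
    · simpa using hp.append (ihq r v rfl)
    · simpa using (ihp u r rfl).append hq
  | @wrap a p hp ih =>
    intro u v h
    rcases u with _ | ⟨x, u⟩
    · simp only [List.nil_append] at h ⊢
      rw [← h]
      exact hm.append (hp.wrap a)
    · simp only [List.cons_append, List.cons.injEq] at h
      obtain ⟨rfl, h⟩ := h
      rcases List.append_eq_append_iff.1 h with ⟨r, rfl, hr⟩ | ⟨r, rfl, rfl⟩
      · rcases r with _ | ⟨y, r⟩
        · simp only [List.nil_append] at hr
          subst hr
          simpa using (hp.append hm).wrap a
        · simp only [List.cons_append, List.cons.injEq, List.nil_eq, List.append_eq_nil_iff] at hr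
          obtain ⟨rfl, rfl, rfl⟩ := hr
          simpa using (hp.wrap a).append hm
      · simpa using (ih u r rfl).wrap a

theorem Accepts.dyck : ∀ (w : List (Paren s)) (S : List (Fin s)), Accepts S w →
    Dyck (S.reverse.map Paren.opn ++ w)
  | [], S, h => by
    simp only [Accepts] at h
    subst h
    exact Dyck.nil
  | Paren.opn a :: w, S, h => by simpa using Accepts.dyck w (a :: S) h
  | Paren.cls _ :: _, [], h => by simp [Accepts] at h
  | Paren.cls b :: w, a :: S, h => by
    obtain ⟨rfl, h⟩ := h
    simpa using (Accepts.dyck w S h).insert (Dyck.nil.wrap a) _ _ rfl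

theorem dyck_iff_accepts {w : List (Paren s)} : Dyck w ↔ Accepts [] w :=
  ⟨Dyck.accepts, fun h => by simpa using Accepts.dyck w [] h⟩

theorem accepts_mid_iff {a b : Fin s} {v : List (Paren s)} :
    ∀ (u : List (Paren s)) (S : List (Fin s)),
      Accepts S (u ++ Paren.opn a :: Paren.cls b :: v) ↔ a = b ∧ Accepts S (u ++ v)
  | [], S => by simp [Accepts]
  | Paren.opn c :: u, S => by simpa [Accepts] using accepts_mid_iff u (c :: S)
  | Paren.cls c :: u, [] => by simp [Accepts]
  | Paren.cls c :: u, e :: S => by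
    have := accepts_mid_iff (a := a) (b := b) (v := v) u S
    simp only [List.cons_append, Accepts, this]
    tauto

theorem dyck_mid_iff {a b : Fin s} {u v : List (Paren s)} :
    Dyck (u ++ Paren.opn a :: Paren.cls b :: v) ↔ a = b ∧ Dyck (u ++ v) := by
  simp only [dyck_iff_accepts, accepts_mid_iff]

theorem not_dyck_cls_cons {b : Fin s} {v : List (Paren s)} : ¬ Dyck (Paren.cls b :: v) := by
  simp [dyck_iff_accepts, Accepts]

theorem not_accepts_map_opn : ∀ (w S : List (Fin s)), S ≠ [] → ¬ Accepts S (w.map Paren.opn)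
  | [], S, h => by simpa [Accepts] using h
  | a :: w, S, _ => by simpa [Accepts] using not_accepts_map_opn w (a :: S) (by simp)

theorem Dyck.eq_nil_of_map_opn {w : List (Fin s)} (h : Dyck (w.map Paren.opn)) : w = [] := by
  rcases w with _ | ⟨a, w⟩
  · rfl
  · exact absurd h.accepts (by simpa [Accepts] using not_accepts_map_opn w [a] (by simp))

/-- A symbol of a Dyck string can be removed together with its partner. -/
theorem Dyck.exists_sublist_erase {w : List (Paren s)} (hw : Dyck w) :
    ∀ (u v : List (Paren s)) (x : Paren s), w = u ++ x :: v →
      ∃ τ, τ <+ u ++ v ∧ Dyck τ ∧ (u ++ v).length = τ.length + 1 := by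
  induction hw with
  | nil => intro u v x h; simp at h
  | @append p q hp hq ihp ihq =>
    intro u v x h
    rcases List.append_eq_append_iff.1 h with ⟨r, rfl, rfl⟩ | ⟨r, rfl, hr⟩
    · obtain ⟨τ, h₁, h₂, h₃⟩ := ihq r v x rfl
      refine ⟨p ++ τ, ?_, hp.append h₂, ?_⟩
      · simpa using h₁
      · simp only [List.length_append] at h₃ ⊢; omega
    · rcases r with _ | ⟨y, r⟩
      · simp only [List.nil_append] at hr
        obtain ⟨τ, h₁, h₂, h₃⟩ := ihq [] v x hr.symm
        refine ⟨u ++ τ, ?_, ?_, ?_⟩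
        · simpa using h₁
        · simpa using hp.append h₂
        · simp only [List.length_append, List.length_nil] at h₃ ⊢; omega
      · simp only [List.cons_append, List.cons.injEq] at hr
        obtain ⟨rfl, rfl⟩ := hr
        obtain ⟨τ, h₁, h₂, h₃⟩ := ihp u r x rfl
        refine ⟨τ ++ q, ?_, h₂.append hq, ?_⟩
        · rw [← List.append_assoc]
          exact h₁.append (List.Sublist.refl q)
        · simp only [List.length_append] at h₃ ⊢; omega
  | @wrap a p hp ih =>
    intro u v x h
    rcases u with _ | ⟨y, u⟩
    · simp only [List.nil_append, List.cons.injEq] at h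
      obtain ⟨rfl, rfl⟩ := h
      exact ⟨p, by simp, hp, by simp⟩
    · simp only [List.cons_append, List.cons.injEq] at h
      obtain ⟨rfl, h⟩ := h
      rcases List.append_eq_append_iff.1 h with ⟨r, rfl, hr⟩ | ⟨r, rfl, hr⟩
      · have hl := congrArg List.length hr
        simp only [List.length_cons, List.length_nil, List.length_append] at hl
        have hr0 : r = [] := List.length_eq_zero_iff.1 (by omega)
        have hv0 : v = [] := List.length_eq_zero_iff.1 (by omega)
        subst hr0 hv0
        exact ⟨p, by simp, hp, by simp⟩
      · rcases r with _ | ⟨y, r⟩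
        · simp only [List.nil_append, List.cons.injEq] at hr
          obtain ⟨rfl, rfl⟩ := hr
          exact ⟨u, by simp, by simpa using hp, by simp⟩
        · simp only [List.cons_append, List.cons.injEq] at hr
          obtain ⟨rfl, rfl⟩ := hr
          obtain ⟨τ, h₁, h₂, h₃⟩ := ih u r x rfl
          refine ⟨Paren.opn a :: (τ ++ [Paren.cls a]), ?_, h₂.wrap a, ?_⟩
          · rw [List.cons_append, ← List.append_assoc]
            exact (h₁.append (List.Sublist.refl _)).cons_cons _
          · simp only [List.length_append, List.length_cons, List.length_nil] at h₃ ⊢; omega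

/-! ### Distance to Dyck strings by deletions alone -/

theorem sublist_append_cons_cases {α : Type*} {τ u v : List α} {x : α}
    (h : τ <+ u ++ x :: v) :
    τ <+ u ++ v ∨ ∃ τ₁ τ₂, τ = τ₁ ++ x :: τ₂ ∧ τ₁ <+ u ∧ τ₂ <+ v := by
  obtain ⟨τ₁, τ₂, rfl, h₁, h₂⟩ := List.sublist_append_iff.1 h
  rcases List.sublist_cons_iff.1 h₂ with h₃ | ⟨r, rfl, h₃⟩
  · exact Or.inl (h₁.append h₃)
  · exact Or.inr ⟨τ₁, r, rfl, h₁, h₃⟩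

/-- At most `k` deletions turn `w` into a Dyck string. -/
def DeletionBound (k : ℕ) (w : List (Paren s)) : Prop :=
  ∃ τ, τ <+ w ∧ Dyck τ ∧ w.length ≤ τ.length + k

theorem Dyck.deletionBound {w : List (Paren s)} (h : Dyck w) : DeletionBound 0 w :=
  ⟨w, List.Sublist.refl w, h, le_rfl⟩

/-- If `x` survives in `τ`, its partner is deleted in its place. -/
theorem DeletionBound.remove {k : ℕ} {u v : List (Paren s)} {x : Paren s}
    (h : DeletionBound k (u ++ x :: v)) : DeletionBound (k + 1) (u ++ v) := by
  obtain ⟨τ, h₁, h₂, h₃⟩ := h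
  simp only [List.length_append, List.length_cons] at h₃
  rcases sublist_append_cons_cases h₁ with h | ⟨τ₁, τ₂, rfl, hu, hv⟩
  · exact ⟨τ, h, h₂, by simp only [List.length_append]; omega⟩
  · obtain ⟨τ', h₄, h₅, h₆⟩ := h₂.exists_sublist_erase τ₁ τ₂ x rfl
    refine ⟨τ', h₄.trans (hu.append hv), h₅, ?_⟩
    simp only [List.length_append, List.length_cons] at h₃ h₆ ⊢
    omega

theorem DeletionBound.add {k : ℕ} {u v : List (Paren s)} (x : Paren s)
    (h : DeletionBound k (u ++ v)) : DeletionBound (k + 1) (u ++ x :: v) := by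
  obtain ⟨τ, h₁, h₂, h₃⟩ := h
  refine ⟨τ, h₁.trans ((List.Sublist.refl u).append (List.sublist_cons_self x v)), h₂, ?_⟩
  simp only [List.length_append, List.length_cons] at h₃ ⊢
  omega

theorem DeletionBound.of_sublist_remove {k : ℕ} {τ u v : List (Paren s)} {x : Paren s}
    (h : τ <+ u ++ v) (hτ : Dyck τ) (hk : (u ++ x :: v).length ≤ τ.length + k) :
    ∃ m, k = m + 1 ∧ DeletionBound m (u ++ v) := by
  have hl := h.length_le
  simp only [List.length_append, List.length_cons] at hk hl
  exact ⟨k - 1, by omega, τ, h, hτ, by simp only [List.length_append]; omega⟩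

/-- If `τ` keeps both symbols, they are adjacent and cancel. If it drops one, the deletion saved
pays for the partner of the other. -/
theorem DeletionBound.matched {k : ℕ} {u v : List (Paren s)} {a : Fin s}
    (h : DeletionBound k (u ++ Paren.opn a :: Paren.cls a :: v)) : DeletionBound k (u ++ v) := by
  obtain ⟨τ, h₁, h₂, h₃⟩ := h
  rcases sublist_append_cons_cases h₁ with h | ⟨τ₁, τ₂, rfl, hu, hv⟩
  · obtain ⟨m, rfl, hm⟩ := DeletionBound.of_sublist_remove h h₂ h₃
    exact hm.remove
  rcases List.sublist_cons_iff.1 hv with hv | ⟨r, rfl, hr⟩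
  · have h₃' : ((u ++ [Paren.opn a]) ++ Paren.cls a :: v).length
        ≤ (τ₁ ++ Paren.opn a :: τ₂).length + k := by simpa using h₃
    obtain ⟨m, rfl, hm⟩ := DeletionBound.of_sublist_remove
      (by simpa using hu.append (hv.cons_cons (Paren.opn a))) h₂ h₃'
    rw [List.append_assoc] at hm
    exact hm.remove
  · refine ⟨τ₁ ++ r, hu.append hr, (dyck_mid_iff.1 h₂).2, ?_⟩
    simp only [List.length_append, List.length_cons] at h₃ ⊢
    omega

/-- Adjacent incongruent symbols cannot both survive in `τ`; deleting one that `τ` omits is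
progress. -/
theorem DeletionBound.mismatched {k : ℕ} {u v : List (Paren s)} {a b : Fin s} (hab : a ≠ b)
    (h : DeletionBound k (u ++ Paren.opn a :: Paren.cls b :: v)) :
    ∃ m, k = m + 1 ∧ (DeletionBound m (u ++ Paren.cls b :: v) ∨
      DeletionBound m (u ++ Paren.opn a :: v)) := by
  obtain ⟨τ, h₁, h₂, h₃⟩ := h
  rcases sublist_append_cons_cases h₁ with h | ⟨τ₁, τ₂, rfl, hu, hv⟩
  · obtain ⟨m, rfl, hm⟩ := DeletionBound.of_sublist_remove h h₂ h₃
    exact ⟨m, rfl, Or.inl hm⟩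
  rcases List.sublist_cons_iff.1 hv with hv | ⟨r, rfl, hr⟩
  · have h₃' : ((u ++ [Paren.opn a]) ++ Paren.cls b :: v).length
        ≤ (τ₁ ++ Paren.opn a :: τ₂).length + k := by simpa using h₃
    obtain ⟨m, rfl, hm⟩ := DeletionBound.of_sublist_remove
      (by simpa using hu.append (hv.cons_cons (Paren.opn a))) h₂ h₃'
    rw [List.append_assoc] at hm
    exact ⟨m, rfl, Or.inr hm⟩
  · exact absurd (dyck_mid_iff.1 h₂).1 hab

theorem DeletionBound.cls_cons {k : ℕ} {v : List (Paren s)} {b : Fin s}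
    (h : DeletionBound k (Paren.cls b :: v)) : ∃ m, k = m + 1 ∧ DeletionBound m v := by
  obtain ⟨τ, h₁, h₂, h₃⟩ := h
  rcases List.sublist_cons_iff.1 h₁ with h | ⟨r, rfl, _⟩
  · exact DeletionBound.of_sublist_remove (u := []) h h₂ h₃
  · exact absurd h₂ not_dyck_cls_cons

theorem DeletionBound.map_opn {k : ℕ} {w : List (Fin s)} {a : Fin s}
    (h : DeletionBound k ((w ++ [a]).map Paren.opn)) :
    ∃ m, k = m + 1 ∧ DeletionBound m (w.map Paren.opn) := by
  obtain ⟨τ, h₁, h₂, h₃⟩ := h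
  obtain ⟨r, _, rfl⟩ := List.sublist_map_iff.1 h₁
  obtain rfl := h₂.eq_nil_of_map_opn
  simp only [List.length_map, List.length_append, List.length_cons, List.length_nil] at h₃
  refine ⟨k - 1, by omega, [], by simp, Dyck.nil, ?_⟩
  simp only [List.length_map, List.length_nil]
  omega

end DyckStrings

/-! ### Edit distance -/

section EditDistance

variable {α : Type}

theorem Edits.trans {k l : ℕ} {σ ρ τ : List α} (h : Edits k σ ρ) (h' : Edits l ρ τ) :
    Edits (k + l) σ τ := by
  induction h with
  | refl => simpa using h'
  | @step k _ _ _ h₁ _ ih =>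
    rw [Nat.add_right_comm]
    exact Edits.step h₁ (ih h')

theorem EditStep.cons (x : α) {σ τ : List α} (h : EditStep σ τ) :
    EditStep (x :: σ) (x :: τ) := by
  cases h with
  | insert u v y => exact EditStep.insert (x :: u) v y
  | delete u v y => exact EditStep.delete (x :: u) v y
  | subst u v y z => exact EditStep.subst (x :: u) v y z

theorem Edits.cons (x : α) {k : ℕ} {σ τ : List α} (h : Edits k σ τ) :
    Edits k (x :: σ) (x :: τ) := by
  induction h with
  | refl => exact Edits.refl _
  | step h₁ _ ih => exact Edits.step (h₁.cons x) ih

theorem List.Sublist.exists_edits {σ τ : List α} (h : τ <+ σ) :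
    ∃ k, σ.length = τ.length + k ∧ Edits k σ τ := by
  induction h with
  | slnil => exact ⟨0, rfl, Edits.refl _⟩
  | cons x _ ih =>
    obtain ⟨k, hk, h⟩ := ih
    exact ⟨k + 1, by simp only [List.length_cons]; omega, Edits.step (EditStep.delete [] _ x) h⟩
  | cons_cons x _ ih =>
    obtain ⟨k, hk, h⟩ := ih
    exact ⟨k, by simp only [List.length_cons]; omega, h.cons x⟩

theorem edits_nil_left (τ : List α) : Edits τ.length [] τ := by
  induction τ with
  | nil => exact Edits.refl _
  | cons x τ ih => exact Edits.step (EditStep.insert [] [] x) (ih.cons x)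

theorem edits_strEdit (σ τ : List α) : Edits (strEdit σ τ) σ τ := by
  obtain ⟨k, _, h⟩ := (List.nil_sublist σ).exists_edits
  exact Nat.sInf_mem (s := {k | Edits k σ τ}) ⟨_, h.trans (edits_nil_left τ)⟩

theorem exists_dyck_edits_dyckDist {s : ℕ} (σ : List (Paren s)) :
    ∃ τ, Dyck τ ∧ Edits (dyckDist σ) σ τ := by
  obtain ⟨τ, h, hτ⟩ := Nat.sInf_mem
    (s := {k : ℕ | ∃ τ : List (Paren s), Dyck τ ∧ strEdit σ τ = k}) ⟨_, [], Dyck.nil, rfl⟩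
  refine ⟨τ, h, ?_⟩
  have := edits_strEdit σ τ
  rwa [hτ] at this

/-- Undoing an insertion or a deletion costs at most one extra deletion. Undoing a substitution, as
a removal followed by an addition, costs two. -/
theorem Edits.deletionBound {s k : ℕ} {σ τ : List (Paren s)} (h : Edits k σ τ) (hτ : Dyck τ) :
    DeletionBound (2 * k) σ := by
  induction h with
  | refl => exact hτ.deletionBound
  | @step k σ ρ τ h₁ _ ih =>
    have hρ := ih hτ
    rw [show 2 * (k + 1) = 2 * k + 1 + 1 by ring]
    cases h₁ with
    | insert u v x =>
      obtain ⟨τ', h, h', h''⟩ := hρ.remove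
      exact ⟨τ', h, h', by omega⟩
    | delete u v x =>
      obtain ⟨τ', h, h', h''⟩ := hρ.add x
      exact ⟨τ', h, h', by omega⟩
    | subst u v x y => exact hρ.remove.add x

end EditDistance

/-! ### The fair random walk on `ℕ` -/

/-- The probability that the fair random walk from `m` reaches `0` within `k` steps. -/
noncomputable def hitProb : ℕ → ℕ → ℝ
  | _, 0 => 1
  | 0, _ + 1 => 0
  | k + 1, m + 1 => (hitProb k m + hitProb k (m + 2)) / 2

theorem hitProb_zero (k : ℕ) : hitProb k 0 = 1 := by cases k <;> simp [hitProb]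

theorem hitProb_nonneg : ∀ k m, 0 ≤ hitProb k m
  | k, 0 => by simp [hitProb_zero]
  | 0, m + 1 => by simp [hitProb]
  | k + 1, m + 1 => by
    have h₁ := hitProb_nonneg k m
    have h₂ := hitProb_nonneg k (m + 2)
    simp only [hitProb]
    positivity

theorem hitProb_le_one : ∀ k m, hitProb k m ≤ 1
  | k, 0 => by simp [hitProb_zero]
  | 0, m + 1 => by simp [hitProb]
  | k + 1, m + 1 => by
    have h₁ := hitProb_le_one k m
    have h₂ := hitProb_le_one k (m + 2)
    simp only [hitProb]
    linarith

theorem hitProb_succ_le : ∀ k m, hitProb k (m + 1) ≤ hitProb k m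
  | k, 0 => by rw [hitProb_zero]; exact hitProb_le_one _ _
  | 0, m + 1 => by simp [hitProb]
  | k + 1, m + 1 => by
    have h₁ := hitProb_succ_le k m
    have h₂ := hitProb_succ_le k (m + 2)
    simp only [hitProb]
    linarith

/-- `y (3k - N² + y²)` is harmonic for the walk in time and space, where `y` is the distance from
the level `N`; it gives a lower bound for the probability of reaching `0`. -/
theorem le_hitProb (K N : ℕ) : ∀ k x y : ℕ, k ≤ K → x + y = N →
    (y : ℝ) * (3 * k - N ^ 2 + y ^ 2) ≤ 3 * N * K * hitProb k x := by
  intro k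
  -- The left side is at most `0` for `k = 0`, equals `3Nk` at `x = 0` and vanishes at `y = 0`.
  -- Inside, the mean of `(y+1)³` and `(y-1)³` is `y³ + 3y`, and `3y` is the gain of one time step.
  induction k with
  | zero =>
    rintro (_ | x) y _ h
    · obtain rfl : y = N := by omega
      simp only [hitProb_zero, CharP.cast_eq_zero]
      have : (0 : ℝ) ≤ 3 * y * K * 1 := by positivity
      linarith
    · have hy : (y : ℝ) ≤ N := by exact_mod_cast (by omega : y ≤ N)
      have hy0 : (0 : ℝ) ≤ y := Nat.cast_nonneg y
      simp only [hitProb, CharP.cast_eq_zero, mul_zero]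
      exact mul_nonpos_of_nonneg_of_nonpos hy0 (by nlinarith)
  | succ k ih =>
    rintro (_ | x) y hk h
    · obtain rfl : y = N := by omega
      have hk' : ((k + 1 : ℕ) : ℝ) ≤ K := by exact_mod_cast hk
      have := mul_le_mul_of_nonneg_left hk' (Nat.cast_nonneg (α := ℝ) y)
      rw [hitProb_zero]
      linarith
    · rcases y with _ | y
      · have := hitProb_nonneg (k + 1) (x + 1)
        simp only [CharP.cast_eq_zero, zero_mul]
        positivity
      · have h₁ := ih x (y + 2) (by omega) (by omega)
        have h₂ := ih (x + 2) y (by omega) (by omega)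
        simp only [hitProb]
        push_cast at h₁ h₂ ⊢
        linarith

theorem one_div_nine_le_hitProb (d : ℕ) : 1 / 9 ≤ hitProb (4 * d * d) (2 * d) := by
  rcases Nat.eq_zero_or_pos d with rfl | hd
  · rw [hitProb_zero]; norm_num
  -- With `N = 3d` and `y = d` the left side is `d(12d² - 9d² + d²) = 4d³`, and the factor on the
  -- right is `36d³`.
  · have h := le_hitProb (4 * d * d) (3 * d) (4 * d * d) (2 * d) d le_rfl (by ring)
    have hd' : (0 : ℝ) < d := by exact_mod_cast hd
    push_cast at h
    have h3 : (0 : ℝ) < d ^ 3 := by positivity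
    have h' : (d : ℝ) ^ 3 * 4 ≤ d ^ 3 * (36 * hitProb (4 * d * d) (2 * d)) := by linarith
    have := le_of_mul_le_mul_left h' h3
    linarith

/-! ### The machine -/

namespace RandomDeletion

variable {s : ℕ}

/-- The string still to be processed: the stack, bottom first, followed by the unread input. -/
def Config.residual (c : Config s) : List (Paren s) :=
  (c.stack.map Prod.fst).reverse.map Paren.opn ++ c.input.map Prod.fst

/-- An upper bound for the number of steps left. -/
def Config.potential (c : Config s) : ℕ := 2 * c.input.length + c.stack.length

/-! ### Comparison of the machine with the walk -/

theorem toOuterMeasure_coin_bind {β γ : Type} (A B : β) (f : β → PMF γ) (E : Set γ) :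
    ((((PMF.uniformOfFintype Bool).bind fun coin =>
      if coin then PMF.pure A else PMF.pure B).bind f).toOuterMeasure E)
      = ((f A).toOuterMeasure E + (f B).toOuterMeasure E) / 2 := by
  rw [PMF.bind_bind, PMF.toOuterMeasure_bind_apply, tsum_fintype, Fintype.sum_bool]
  simp [PMF.uniformOfFintype_apply, ENNReal.div_eq_inv_mul, mul_add]

theorem ofReal_half_add_le {x y : ℝ} {X Y : ENNReal} (hx : 0 ≤ x) (hy : 0 ≤ y)
    (h₁ : ENNReal.ofReal x ≤ X) (h₂ : ENNReal.ofReal y ≤ Y) :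
    ENNReal.ofReal ((x + y) / 2) ≤ (X + Y) / 2 := by
  rw [ENNReal.ofReal_div_of_pos two_pos, ENNReal.ofReal_add hx hy, ENNReal.ofReal_ofNat]
  gcongr

/-- The walk's clock `k` counts deletions, not machine steps, so `t` is arbitrary. -/
theorem hitProb_le_run (t : ℕ) : ∀ (c : Config s) (k m : ℕ), DeletionBound m c.residual →
    ENNReal.ofReal (hitProb k m) ≤
      (run t c).toOuterMeasure {c' | c'.edits ≤ c.edits + k} := by
  induction t with
  | zero =>
    intro c k m _
    simp only [run, PMF.toOuterMeasure_pure_apply, Set.mem_ofPred_eq]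
    rw [if_pos (Nat.le_add_right _ _)]
    exact ENNReal.ofReal_le_one.2 (hitProb_le_one k m)
  | succ t ih =>
    rintro ⟨I, S, D⟩ k m h
    have deletion : ∀ (I' : List (Paren s × ℕ)) (S' : List (Fin s × ℕ)) (i j l : ℕ),
        DeletionBound l (Config.residual ⟨I', S', i :: D⟩) →
        ENNReal.ofReal (hitProb j l) ≤ (run t ⟨I', S', i :: D⟩).toOuterMeasure
          {c' | c'.edits ≤ (Config.mk I S D).edits + (j + 1)} := by
      intro I' S' i j l hl
      convert ih _ j l hl using 4
      simp only [Config.edits, List.length_cons]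
      omega
    have single : ∀ (I' : List (Paren s × ℕ)) (S' : List (Fin s × ℕ)) (i : ℕ),
        (∃ l, m = l + 1 ∧ DeletionBound l (Config.residual ⟨I', S', i :: D⟩)) →
        ENNReal.ofReal (hitProb k m) ≤ (run t ⟨I', S', i :: D⟩).toOuterMeasure
          {c' | c'.edits ≤ (Config.mk I S D).edits + k} := by
      rintro I' S' i ⟨l, rfl, hl⟩
      rcases k with _ | k
      · simp [hitProb]
      -- A sure move down is at least as good as a fair step, as `hitProb` decreases in the starting
      -- point.
      · refine (ENNReal.ofReal_le_ofReal ?_).trans (deletion I' S' i k l hl)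
        have h₁ := hitProb_succ_le k l
        have h₂ := hitProb_succ_le k (l + 1)
        simp only [hitProb]
        linarith
    rcases I with _ | ⟨⟨x | b, j⟩, I⟩
    · rcases S with _ | ⟨⟨a, i⟩, S⟩
      · simp only [run, step, PMF.pure_bind]
        exact ih _ k m h
      · simp only [run, step, PMF.pure_bind]
        refine single _ _ _ ?_
        simpa [Config.residual] using
          DeletionBound.map_opn (w := (S.map Prod.fst).reverse) (a := a)
            (by simpa [Config.residual] using h)
    · simp only [run, step, PMF.pure_bind]
      exact ih _ k m (by simpa [Config.residual] using h)
    · rcases S with _ | ⟨⟨a, i⟩, S⟩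
      · simp only [run, step, PMF.pure_bind]
        exact single _ _ _ (by simpa [Config.residual] using DeletionBound.cls_cons h)
      · have h' : DeletionBound m ((S.map Prod.fst).reverse.map Paren.opn ++
            Paren.opn a :: Paren.cls b :: I.map Prod.fst) := by
          simpa [Config.residual] using h
        by_cases hab : a = b
        · subst hab
          simp only [run, step, if_true, PMF.pure_bind]
          exact ih _ k m (by simpa [Config.residual] using h'.matched)
        · simp only [run, step, if_neg hab]
          rw [toOuterMeasure_coin_bind]
          obtain ⟨l, rfl, hl⟩ := h'.mismatched hab
          rcases k with _ | k
          · simp [hitProb]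
          have pop : DeletionBound (l + 2)
              (Config.residual ⟨(Paren.cls b, j) :: I, S, i :: D⟩) := by
            simpa [Config.residual] using h'.remove
          have skip : DeletionBound (l + 2)
              (Config.residual ⟨I, (a, i) :: S, j :: D⟩) := by
            rw [← List.singleton_append, ← List.append_assoc] at h'
            simpa [Config.residual] using h'.remove
          simp only [hitProb]
          -- Which coin outcome is the good one is unknown to the machine, but both have weight one
          -- half.
          rcases hl with hl | hl
          · exact ofReal_half_add_le (hitProb_nonneg _ _) (hitProb_nonneg _ _)
              (deletion _ _ _ _ _ (by simpa [Config.residual] using hl))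
              (deletion _ _ _ _ _ skip)
          · rw [add_comm (hitProb k l)]
            exact ofReal_half_add_le (hitProb_nonneg _ _) (hitProb_nonneg _ _)
              (deletion _ _ _ _ _ pop)
              (deletion _ _ _ _ _ (by simpa [Config.residual] using hl))

/-- `K` is what has been read and kept: the open parentheses on the stack, with Dyck strings below,
between and above them. -/
def Layered : List (Fin s × ℕ) → List (Paren s × ℕ) → Prop
  | [], K => Dyck (K.map Prod.fst)
  | (a, i) :: S, K => ∃ K₁ K₂, K = K₁ ++ (Paren.opn a, i) :: K₂ ∧ Layered S K₁ ∧
      Dyck (K₂.map Prod.fst)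

/-- When the stack top goes, the Dyck string above it merges with the layer below. -/
theorem Layered.append {S : List (Fin s × ℕ)} {K Q : List (Paren s × ℕ)} (h : Layered S K)
    (hQ : Dyck (Q.map Prod.fst)) : Layered S (K ++ Q) := by
  rcases S with _ | ⟨⟨a, i⟩, S⟩
  · simpa [Layered] using Dyck.append h hQ
  · obtain ⟨K₁, K₂, rfl, h₁, h₂⟩ := h
    exact ⟨K₁, K₂ ++ Q, by simp, h₁, by simpa using h₂.append hQ⟩

/-- The symbols of `σ` are divided among the kept ones, the unread ones and the deleted ones. -/
def Invariant (σ : List (Paren s)) (c : Config s) : Prop :=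
  ∃ K, Layered c.stack K ∧ K ++ c.input <+ σ.zipIdx ∧
    (c.deleted ++ (K ++ c.input).map Prod.snd).Perm (List.range σ.length)

theorem invariant_init (σ : List (Paren s)) : Invariant σ (init σ) :=
  ⟨[], Dyck.nil, by simp [init], by simp [init, List.zipIdx_map_snd, List.range_eq_range']⟩

/-- The split at `x` is independent of the split into kept and unread symbols, so `x` may be the
current symbol or the stack top. -/
theorem Invariant.delete {σ : List (Paren s)} {I' : List (Paren s × ℕ)}
    {S : List (Fin s × ℕ)} {D : List ℕ} {K u v : List (Paren s × ℕ)} {x : Paren s × ℕ}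
    (h₁ : u ++ x :: v <+ σ.zipIdx)
    (h₂ : (D ++ (u ++ x :: v).map Prod.snd).Perm (List.range σ.length))
    (hK : Layered S K) (he : K ++ I' = u ++ v) : Invariant σ ⟨I', S, x.2 :: D⟩ := by
  refine ⟨K, hK, ?_, ?_⟩
  · rw [he]
    exact ((List.Sublist.refl u).append (List.sublist_cons_self x v)).trans h₁
  · rw [he]
    refine List.Perm.trans ?_ h₂
    simp only [List.map_append, List.map_cons, List.cons_append]
    rw [← List.append_assoc, ← List.append_assoc]
    exact List.perm_middle.symm

/-- Unread symbols weigh two, so even a push lowers the potential. Truncated subtraction covers the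
halted machine, of potential `0`. -/
theorem Invariant.step {σ : List (Paren s)} {c c' : Config s} (h : Invariant σ c)
    (hc' : c' ∈ (step c).support) : Invariant σ c' ∧ c'.potential ≤ c.potential - 1 := by
  obtain ⟨I, S, D⟩ := c
  obtain ⟨K, hK, h₁, h₂⟩ := h
  simp only at hK h₁ h₂
  rcases I with _ | ⟨⟨x | b, j⟩, I⟩
  · rcases S with _ | ⟨⟨a, i⟩, S⟩
    · simp only [RandomDeletion.step, PMF.support_pure, Set.mem_singleton_iff] at hc'
      subst hc'
      exact ⟨⟨K, hK, h₁, h₂⟩, by simp [Config.potential]⟩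
    · simp only [RandomDeletion.step, PMF.support_pure, Set.mem_singleton_iff] at hc'
      subst hc'
      obtain ⟨K₁, K₂, rfl, h₃, h₄⟩ := hK
      simp only [List.append_nil] at h₁ h₂
      exact ⟨Invariant.delete h₁ h₂ (h₃.append h₄) (by simp),
        by simp [Config.potential]⟩
  · simp only [RandomDeletion.step, PMF.support_pure, Set.mem_singleton_iff] at hc'
    subst hc'
    refine ⟨⟨K ++ [(Paren.opn x, j)], ⟨K, [], rfl, hK, Dyck.nil⟩, by simpa using h₁,
      by simpa using h₂⟩, ?_⟩
    simp only [Config.potential, List.length_cons]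
    omega
  · rcases S with _ | ⟨⟨a, i⟩, S⟩
    · simp only [RandomDeletion.step, PMF.support_pure, Set.mem_singleton_iff] at hc'
      subst hc'
      refine ⟨Invariant.delete h₁ h₂ hK rfl, ?_⟩
      simp only [Config.potential, List.length_cons]
      omega
    · by_cases hab : a = b
      · subst hab
        simp only [RandomDeletion.step, if_true, PMF.support_pure, Set.mem_singleton_iff] at hc'
        subst hc'
        obtain ⟨K₁, K₂, rfl, h₃, h₄⟩ := hK
        refine ⟨⟨K₁ ++ (Paren.opn a, i) :: (K₂ ++ [(Paren.cls a, j)]),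
          h₃.append (by simpa using h₄.wrap a), by simpa using h₁, by simpa using h₂⟩, ?_⟩
        simp only [Config.potential, List.length_cons]
        omega
      · simp only [RandomDeletion.step, if_neg hab, PMF.mem_support_bind_iff] at hc'
        obtain ⟨coin, _, hc'⟩ := hc'
        cases coin
        · simp only [Bool.false_eq_true, if_false, PMF.support_pure,
            Set.mem_singleton_iff] at hc'
          subst hc'
          refine ⟨Invariant.delete h₁ h₂ hK rfl, ?_⟩
          simp only [Config.potential, List.length_cons]
          omega
        · simp only [if_true, PMF.support_pure, Set.mem_singleton_iff] at hc'
          subst hc'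
          obtain ⟨K₁, K₂, rfl, h₃, h₄⟩ := hK
          rw [List.append_assoc, List.cons_append] at h₁ h₂
          refine ⟨Invariant.delete h₁ h₂ (h₃.append h₄) (by simp), ?_⟩
          simp only [Config.potential, List.length_cons]
          omega

theorem Invariant.run {σ : List (Paren s)} (t : ℕ) : ∀ {c c' : Config s}, Invariant σ c →
    c.potential ≤ t → c' ∈ (run t c).support → Invariant σ c' ∧ c'.Halted := by
  induction t with
  | zero =>
    intro c c' h ht hc'
    simp only [RandomDeletion.run, PMF.support_pure, Set.mem_singleton_iff] at hc'
    subst hc'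
    simp only [Config.potential] at ht
    exact ⟨h, List.length_eq_zero_iff.1 (by omega), List.length_eq_zero_iff.1 (by omega)⟩
  | succ t ih =>
    intro c c' h ht hc'
    simp only [RandomDeletion.run, PMF.mem_support_bind_iff] at hc'
    obtain ⟨c₁, h₁, h₂⟩ := hc'
    obtain ⟨h₃, h₄⟩ := h.step h₁
    exact ih h₃ (by omega) h₂

/-- What a halted machine has output. -/
theorem Invariant.correct {σ : List (Paren s)} {c : Config s} (h : Invariant σ c)
    (hc : c.Halted) :
    c.deleted.Nodup ∧ (∀ i ∈ c.deleted, i < σ.length) ∧ Dyck (c.result σ) ∧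
      c.result σ <+ σ ∧ σ.length = (c.result σ).length + c.edits := by
  obtain ⟨I, S, D⟩ := c
  obtain ⟨rfl, rfl⟩ : I = [] ∧ S = [] := hc
  obtain ⟨K, hK, h₁, h₂⟩ := h
  simp only [List.append_nil] at hK h₁ h₂
  have hnd : (D ++ K.map Prod.snd).Nodup := h₂.nodup_iff.2 List.nodup_range
  have hdisj := List.disjoint_of_nodup_append hnd
  have hKf : K = σ.zipIdx.filter fun x => x.2 ∉ D := by
    have hsub : K <+ σ.zipIdx.filter fun x => x.2 ∉ D := by
      have := h₁.filter fun x => x.2 ∉ D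
      rwa [List.filter_eq_self.2] at this
      intro x hx
      simpa using fun hD => hdisj hD (List.mem_map_of_mem hx)
    -- Conversely, the undeleted positions are distinct and all occur in `K`, so the filtered list
    -- is no longer than `K`.
    refine hsub.eq_of_length_le ?_
    have hsn : ((σ.zipIdx.filter fun x => x.2 ∉ D).map Prod.snd).Nodup := by
      refine List.Nodup.sublist (List.filter_sublist.map Prod.snd) ?_
      rw [List.zipIdx_map_snd]
      exact List.nodup_range'
    have hss : ((σ.zipIdx.filter fun x => x.2 ∉ D).map Prod.snd) ⊆ K.map Prod.snd := by
      intro i hi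
      obtain ⟨⟨x, i⟩, hx, rfl⟩ := List.mem_map.1 hi
      obtain ⟨hx, hD⟩ := List.mem_filter.1 hx
      have hi' : i ∈ σ.zipIdx.map Prod.snd := List.mem_map_of_mem (f := Prod.snd) hx
      rw [List.zipIdx_map_snd, ← List.range_eq_range', ← h₂.mem_iff, List.mem_append] at hi'
      exact hi'.resolve_left (by simpa using hD)
    simpa using (hsn.subperm hss).length_le
  have hres : (Config.mk [] [] D).result σ = K.map Prod.fst := by
    simp only [Config.result]
    rw [hKf]
  refine ⟨(List.nodup_append.1 hnd).1, fun i hi => ?_, ?_, ?_, ?_⟩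
  · exact List.mem_range.1 (h₂.mem_iff.1 (List.mem_append_left _ hi))
  · rw [hres]; exact hK
  · rw [hres]
    simpa using h₁.map Prod.fst
  · have := h₂.length_eq
    simp only [List.length_append, List.length_map, List.length_range] at this
    rw [hres, List.length_map]
    simp only [Config.edits]
    omega

end RandomDeletion

theorem theorem1 :
    ∃ (C : ℕ) (p : ℝ), 0 < p ∧
      ∀ (s : ℕ), 2 ≤ s → ∀ σ : List (Paren s),
        -- whatever the coins, the machine halts within `C * n` steps, and its output is correct
        (∀ c ∈ (RandomDeletion.run (C * σ.length) (RandomDeletion.init σ)).support,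
          c.Halted ∧
          c.deleted.Nodup ∧ (∀ i ∈ c.deleted, i < σ.length) ∧
          Dyck (c.result σ) ∧
          strEdit σ (c.result σ) ≤ c.edits ∧
          dyckDist σ ≤ c.edits) ∧
        -- with probability at least `p`, the number of edits is at most `4d` times the optimum `d`
        ENNReal.ofReal p ≤
          (RandomDeletion.run (C * σ.length) (RandomDeletion.init σ)).toOuterMeasure
            {c | c.edits ≤ (4 * dyckDist σ) * dyckDist σ} := by
  -- `2 * σ.length` is the potential of the initial configuration.
  refine ⟨2, 1 / 9, by norm_num, fun s _ σ => ⟨fun c hc => ?_, ?_⟩⟩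
  · obtain ⟨hinv, hhalt⟩ := (RandomDeletion.invariant_init σ).run _
      (by simp [RandomDeletion.Config.potential, RandomDeletion.init]) hc
    obtain ⟨hnd, hlt, hdyck, hsub, hlen⟩ := hinv.correct hhalt
    obtain ⟨k, hk, hedits⟩ := hsub.exists_edits
    obtain rfl : k = c.edits := by omega
    have hstr : strEdit σ (c.result σ) ≤ c.edits := Nat.sInf_le hedits
    exact ⟨hhalt, hnd, hlt, hdyck, hstr,
      le_trans (Nat.sInf_le (Exists.intro _ ⟨hdyck, rfl⟩)) hstr⟩
  · obtain ⟨τ, hτ, hedits⟩ := exists_dyck_edits_dyckDist σ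
    refine (ENNReal.ofReal_le_ofReal (one_div_nine_le_hitProb (dyckDist σ))).trans ?_
    have h := RandomDeletion.hitProb_le_run (2 * σ.length) (RandomDeletion.init σ)
      (4 * dyckDist σ * dyckDist σ) (2 * dyckDist σ)
      (by simpa [RandomDeletion.Config.residual, RandomDeletion.init] using
        hedits.deletionBound hτ)
    simpa [RandomDeletion.Config.edits, RandomDeletion.init] using h
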